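/- **Plausibility spaces.** A plausibility space is a pair $S=(\Omega,\mathrm{Pl})$, where $\mathrm{Pl}$ maps the subsets of $\Omega$ to a partially ordered set with least element $\bot$ and greatest element $\top$ (possibly $\bot=\top$), $\mathrm{Pl}(\emptyset)=\bot$, $\mathrm{Pl}(\Omega)=\top$, and $A\subseteq B$ implies $\mathrm{Pl}(A)\le \mathrm{Pl}(B)$. The domain of values is not part of the space: two spaces are equal if they have the same $\Omega$ and induce the same ordering $\mathrm{Pl}(A)\le\mathrm{Pl}(B)$ on subsets of $\Omega$. $S$ is *qualitative* if (A2) for pairwise disjoint $A,B,C$, $\mathrm{Pl}(A\cup B)>\mathrm{Pl}(C)$ and $\mathrm{Pl}(A\cup C)>\mathrm{Pl}(B)$ imply $\mathrm{Pl}(A)>\mathrm{Pl}(B\cup C)$, and (A3) $\mathrm{Pl}(A)=\mathrm{Pl}(B)=\bot$ implies $\mathrm{Pl}(A\cup B)=\bot$. It is a *ranking* if any two values $\mathrm{Pl}(A),\mathrm{Pl}(B)$ are comparable and $\mathrm{Pl}(A\cup B)=\max(\mathrm{Pl}(A),\mathrm{Pl}(B))$. **Systems.** Fix agents $1,\dots,n$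 and a set of primitive propositions. An interpreted plausibility system $\mathcal I=(\mathcal R,\pi,\mathcal P_1,\dots,\mathcal P_n)$ consists of a set $\mathcal R$ of runs (functions from $\mathbb N$ to global states, a global state being an environment state together with a local state for each agent), a truth assignment $\pi$ to the primitive propositions at each global state, and, for each agent $i$ and each point $(r,m)\in\mathcal R\times\mathbb N$, a plausibility space $\mathcal P_i(r,m)=(\Omega_{(r,m,i)},\mathrm{Pl}_{(r,m,i)})$ with $\Omega_{(r,m,i)}$ a set of points. Write $r_i(m)$ for agent $i$'s local state at $(r,m)$, $(r,m)\sim_i(r',m')$ if $r_i(m)=r'_i(m')$, $\mathcal K_i(r,m)$ for the set of points $\sim_i$-equivalent to $(r,m)$, and $\mathcal R(A)$ for the set of runs on which the points of a set $A$ lie. **Language.** Formulas of $\mathcal L^{KCT}$ are built from primitive propositions with $\neg$, $\wedge$, $K_i$, $\to_i$ and $\bigcirc$. $K_i\varphi$ holds at $(r,m)$ if $\varphi$ holds at all points of $\mathcal K_i(r,m)$; $\bigcirc\varphi$ holds at $(r,m)$ if $\varphi$ holds at $(r,m+1)$; and $\varphi\to_i\psi$ holds at $(r,m)$ if $\mathrm{Pl}_{(r,m,i)}([\![\varphi]\!])=\bot$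 or $\mathrm{Pl}_{(r,m,i)}([\![\varphi\wedge\psi]\!])>\mathrm{Pl}_{(r,m,i)}([\![\varphi\wedge\neg\psi]\!])$, where $[\![\chi]\!]$ is the set of points of $\Omega_{(r,m,i)}$ at which $\chi$ holds. A formula is *temporally linear* if $\bigcirc$ does not occur in it in the scope of any $K_i$ or $\to_i$. **Conditions** (for all agents $i$, points $p$, runs $r,r'$, times $m$): - QUAL: $\mathcal P_i(p)$ is qualitative. RANK: $\mathcal P_i(p)$ is a ranking. NORM: $\top>\bot$ in $\mathcal P_i(p)$. - REF: $p\in\Omega_{(p,i)}$, and $\mathrm{Pl}_{(p,i)}(A)>\bot$ whenever $p\in A\subseteq\Omega_{(p,i)}$. - CONS: $\Omega_{(p,i)}\subseteq\mathcal K_i(p)$. - SDP: $\mathcal P_i(p)=\mathcal P_i(q)$ for all $q\in\mathcal K_i(p)$. UNIF: $\mathcal P_i(p)=\mathcal P_i(q)$ for all $q\in\Omega_{(p,i)}$. - Synchrony: $(r,m)\sim_i(r',m')$ only if $m=m'$. Perfect recall (for synchronous systems): $(r',m+1)\sim_i(r,m+1)$ implies $(r',m)\sim_i(r,m)$. - Coherence: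 if $R\subseteq\mathcal R$, $A\subseteq\Omega_{(r,m,i)}$, $\mathcal R(A)=R\cap\mathcal R(\Omega_{(r,m,i)})$, $A'\subseteq\Omega_{(r,m+1,i)}$, $\mathcal R(A')=R\cap\mathcal R(\Omega_{(r,m+1,i)})$ and $\mathrm{Pl}_{(r,m,i)}(A)=\bot$, then $\mathrm{Pl}_{(r,m+1,i)}(A')=\bot$. - PERSIST: if $(r,m+1)\sim_i(r',m+1)$, then $\mathcal P_i(r,m+1)=\mathcal P_i(r',m+1)$ if and only if $\mathcal P_i(r,m)=\mathcal P_i(r',m)$. - PRIOR: the system is synchronous, and for each $r$ and $i$ there is a plausibility space $(\mathcal R_{(r,i)},\mathrm{Pl}_{(r,i)})$ with $\mathcal R_{(r,i)}\subseteq\mathcal R$ (the prior) such that for all $m$, $\Omega_{(r,m,i)}=\{(r',m)\in\mathcal K_i(r,m):r'\in\mathcal R_{(r,i)}\}$ and $\mathrm{Pl}_{(r,m,i)}(A)=\mathrm{Pl}_{(r,i)}|_{\mathcal R(\mathcal K_i(r,m))}(\mathcal R(A))$ for all $A\subseteq\Omega_{(r,m,i)}$ (equality as plausibility measures, that is, the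 two sides order the sets $A$ in the same way), where $\mathrm{Pl}|_E$ is the restriction of $\mathrm{Pl}$ to subsets of $E$. **Theorem.** Let $\mathcal A$ be a subset of $\{\mathrm{QUAL},\mathrm{NORM},\mathrm{REF},\mathrm{SDP},\mathrm{UNIF},\mathrm{RANK}\}$ and let $\mathcal I$ be a coherent synchronous system satisfying perfect recall, CONS, PERSIST, and every condition in $\mathcal A$. Then there are a synchronous system $\mathcal I'$ satisfying perfect recall, PRIOR, and every condition in $\mathcal A$, and a mapping $f:\mathcal R\to\mathcal R'$, such that for all temporally linear formulas $\varphi\in\mathcal L^{KCT}$ and all points $(r,m)$ of $\mathcal I$, $(\mathcal I,r,m)\models\varphi$ if and only if $(\mathcal I',f(r),m)\models\varphi$. -/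

import Mathlib

universe u v

/-- A plausibility space over subsets of `W`: an underlying set `carrier ⊆ W`, a pointed partially
ordered domain `D` of plausibility values, and a monotone assignment of values to the subsets of
`carrier` with `Pl ∅ = ⊥` and `Pl carrier = ⊤` (where `⊥ = ⊤` is allowed).
All subsets of `carrier` are measurable; the values of `Pl` at other sets are never used. -/
structure PlausibilitySpace (W : Type u) : Type (u + 1) where
  carrier : Set W
  D : Type u
  [order : PartialOrder D]
  [bounded : BoundedOrder D]
  Pl : Set W → D
  Pl_empty : Pl ∅ = ⊥
  Pl_carrier : Pl carrier = ⊤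
  mono : ∀ A B : Set W, A ⊆ B → B ⊆ carrier → Pl A ≤ Pl B

attribute [instance] PlausibilitySpace.order PlausibilitySpace.bounded

namespace PlausibilitySpace

variable {W : Type u}

/-- Identity of plausibility spaces.  The domain of values is not part of a plausibility space,
only the ordering that it induces on sets is, so two spaces are the same when they have the same
underlying set and order its subsets in the same way. -/
def Same (S T : PlausibilitySpace W) : Prop :=
  S.carrier = T.carrier ∧
    ∀ A B : Set W, A ⊆ S.carrier → B ⊆ S.carrier → (S.Pl A ≤ S.Pl B ↔ T.Pl A ≤ T.Pl B)

/-- The projection of `S` on `E`: the underlying set is `carrier ∩ E`, and `Pl` is restricted to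
the subsets of it.  The domain is cut down to the values below that of `carrier ∩ E`, which becomes
the top element. -/
def proj (S : PlausibilitySpace W) (E : Set W) : PlausibilitySpace W where
  carrier := S.carrier ∩ E
  D := Set.Iic (S.Pl (S.carrier ∩ E))
  bounded :=
    { top := ⟨S.Pl (S.carrier ∩ E), le_refl _⟩
      le_top := fun a => a.2
      bot := ⟨⊥, bot_le⟩
      bot_le := fun _ => bot_le (α := S.D) }
  Pl := fun A => ⟨S.Pl (A ∩ (S.carrier ∩ E)),
    S.mono _ _ Set.inter_subset_right Set.inter_subset_left⟩
  Pl_empty := Subtype.ext (by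
    show S.Pl (∅ ∩ (S.carrier ∩ E)) = ⊥
    rw [Set.empty_inter, S.Pl_empty])
  Pl_carrier := Subtype.ext (by
    show S.Pl ((S.carrier ∩ E) ∩ (S.carrier ∩ E)) = S.Pl (S.carrier ∩ E)
    rw [Set.inter_self])
  mono := fun A B h _ => S.mono (A ∩ (S.carrier ∩ E)) (B ∩ (S.carrier ∩ E))
    (Set.inter_subset_inter_left _ h) (Set.inter_subset_right.trans Set.inter_subset_left)

/-- Qualitative plausibility spaces: conditions A2 and A3. -/
def Qualitative (S : PlausibilitySpace W) : Prop :=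
  (∀ A B C : Set W, A ⊆ S.carrier → B ⊆ S.carrier → C ⊆ S.carrier →
      Disjoint A B → Disjoint A C → Disjoint B C →
      S.Pl C < S.Pl (A ∪ B) → S.Pl B < S.Pl (A ∪ C) → S.Pl (B ∪ C) < S.Pl A) ∧
  (∀ A B : Set W, A ⊆ S.carrier → B ⊆ S.carrier →
      S.Pl A = ⊥ → S.Pl B = ⊥ → S.Pl (A ∪ B) = ⊥)

/-- Rankings: the values of any two sets are comparable, and the value of `A ∪ B` is the maximum of
those of `A` and `B`. -/
def IsRanking (S : PlausibilitySpace W) : Prop :=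
  ∀ A B : Set W, A ⊆ S.carrier → B ⊆ S.carrier →
    (S.Pl A ≤ S.Pl B ∨ S.Pl B ≤ S.Pl A) ∧ IsGreatest {S.Pl A, S.Pl B} (S.Pl (A ∪ B))

end PlausibilitySpace

/-- The language of knowledge, conditional plausibility and time for agents `i : Fin n` and
primitive propositions `Φ`. -/
inductive Formula (n : ℕ) (Φ : Type v) : Type v
  | prim (p : Φ) : Formula n Φ
  | neg (φ : Formula n Φ) : Formula n Φ
  | conj (φ ψ : Formula n Φ) : Formula n Φ
  | know (i : Fin n) (φ : Formula n Φ) : Formula n Φ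
  | cond (i : Fin n) (φ ψ : Formula n Φ) : Formula n Φ
  | next (φ : Formula n Φ) : Formula n Φ

namespace Formula

variable {n : ℕ} {Φ : Type v}

/-- The formula contains no temporal modality. -/
def TimeFree : Formula n Φ → Prop
  | prim _ => True
  | neg φ => φ.TimeFree
  | conj φ ψ => φ.TimeFree ∧ ψ.TimeFree
  | know _ φ => φ.TimeFree
  | cond _ φ ψ => φ.TimeFree ∧ ψ.TimeFree
  | next _ => False

/-- No temporal modality occurs in the scope of a knowledge or conditional modality. -/
def TemporallyLinear : Formula n Φ → Prop
  | prim _ => True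
  | neg φ => φ.TemporallyLinear
  | conj φ ψ => φ.TemporallyLinear ∧ ψ.TemporallyLinear
  | know _ φ => φ.TimeFree
  | cond _ φ ψ => φ.TimeFree ∧ ψ.TimeFree
  | next φ => φ.TemporallyLinear

end Formula

/-- An interpreted plausibility system with agents `i : Fin n`.  A global state is an environment
state together with a local state for each agent, a run is a function from time to global states,
and a point is a run of the system together with a time.  `val` is the truth assignment at each
global state, and `pl i` is the plausibility assignment of agent `i`. -/
structure InterpretedSystem (n : ℕ) (Φ : Type v) : Type (max (u + 1) v) where
  Env : Type u
  Loc : Fin n → Type u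
  runs : Set (ℕ → Env × (∀ i, Loc i))
  val : Env × (∀ i, Loc i) → Φ → Prop
  pl : Fin n → ↥runs × ℕ → PlausibilitySpace (↥runs × ℕ)

namespace InterpretedSystem

variable {n : ℕ} {Φ : Type v} (I : InterpretedSystem.{u, v} n Φ)

abbrev Run : Type u := ↥I.runs

abbrev Point : Type u := I.Run × ℕ

/-- The local state of agent `i` at a point. -/
def localState (i : Fin n) (p : I.Point) : I.Loc i := (p.1.1 p.2).2 i

/-- The points that agent `i` considers possible at `p`: those at which her local state is the same
as at `p`. -/
def poss (i : Fin n) (p : I.Point) : Set I.Point := {q | I.localState i q = I.localState i p}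

/-- The set of points to which agent `i` assigns a degree of plausibility at `p`. -/
def Om (i : Fin n) (p : I.Point) : Set I.Point := (I.pl i p).carrier

/-- The set of runs on which the points in `A` lie. -/
def runsOf (A : Set I.Point) : Set I.Run := {r | ∃ m, (r, m) ∈ A}

/-- Truth of a formula at a point. -/
def Sat : I.Point → Formula n Φ → Prop
  | p, .prim a => I.val (p.1.1 p.2) a
  | p, .neg φ => ¬ Sat p φ
  | p, .conj φ ψ => Sat p φ ∧ Sat p ψ
  | p, .know i φ => ∀ q ∈ I.poss i p, Sat q φ
  | p, .cond i φ ψ =>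
      (I.pl i p).Pl {q | q ∈ I.Om i p ∧ Sat q φ} = ⊥ ∨
        (I.pl i p).Pl {q | q ∈ I.Om i p ∧ (Sat q φ ∧ ¬ Sat q ψ)} <
          (I.pl i p).Pl {q | q ∈ I.Om i p ∧ (Sat q φ ∧ Sat q ψ)}
  | p, .next φ => Sat (p.1, p.2 + 1) φ

def QUAL : Prop := ∀ i p, (I.pl i p).Qualitative

def CONS : Prop := ∀ i p, I.Om i p ⊆ I.poss i p

def NORM : Prop := ∀ i p, (⊥ : (I.pl i p).D) < ⊤

def REF : Prop :=
  ∀ i p, p ∈ I.Om i p ∧ ∀ A : Set I.Point, A ⊆ I.Om i p → p ∈ A → ⊥ < (I.pl i p).Pl A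

def SDP : Prop := ∀ i p, ∀ q ∈ I.poss i p, (I.pl i p).Same (I.pl i q)

def UNIF : Prop := ∀ i p, ∀ q ∈ I.Om i p, (I.pl i p).Same (I.pl i q)

def RANK : Prop := ∀ i p, (I.pl i p).IsRanking

def Synchronous : Prop := ∀ (i : Fin n) (p q : I.Point), q ∈ I.poss i p → p.2 = q.2

/-- Perfect recall, for synchronous systems. -/
def PerfectRecall : Prop :=
  ∀ (i : Fin n) (r r' : I.Run) (m : ℕ),
    (r', m + 1) ∈ I.poss i (r, m + 1) → (r', m) ∈ I.poss i (r, m)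

/-- Coherence: sets of runs that are implausible at time `m` remain so at time `m + 1`. -/
def Coherent : Prop :=
  ∀ (i : Fin n) (r : I.Run) (m : ℕ) (R : Set I.Run) (A A' : Set I.Point),
    A ⊆ I.Om i (r, m) → I.runsOf A = R ∩ I.runsOf (I.Om i (r, m)) →
    A' ⊆ I.Om i (r, m + 1) → I.runsOf A' = R ∩ I.runsOf (I.Om i (r, m + 1)) →
    (I.pl i (r, m)).Pl A = ⊥ → (I.pl i (r, m + 1)).Pl A' = ⊥

def PERSIST : Prop :=
  ∀ (i : Fin n) (r r' : I.Run) (m : ℕ), (r', m + 1) ∈ I.poss i (r, m + 1) →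
    ((I.pl i (r, m + 1)).Same (I.pl i (r', m + 1)) ↔ (I.pl i (r, m)).Same (I.pl i (r', m)))

/-- The plausibility space of agent `i` at `(r, m)` is the time `m` projection of the space `prior`
on runs, conditioned on the set of runs that the agent considers possible at `(r, m)`. -/
def IsTimeProjection (i : Fin n) (r : I.Run) (m : ℕ) (prior : PlausibilitySpace I.Run) : Prop :=
  I.Om i (r, m) = {q | q ∈ I.poss i (r, m) ∧ q.2 = m ∧ q.1 ∈ prior.carrier} ∧
  ∀ A B : Set I.Point, A ⊆ I.Om i (r, m) → B ⊆ I.Om i (r, m) →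
    ((I.pl i (r, m)).Pl A ≤ (I.pl i (r, m)).Pl B ↔
      (prior.proj (I.runsOf (I.poss i (r, m)))).Pl (I.runsOf A) ≤
        (prior.proj (I.runsOf (I.poss i (r, m)))).Pl (I.runsOf B))

/-- The plausibility assignments are obtained by conditioning from priors on runs, one for each run
and agent. -/
def PRIOR : Prop :=
  I.Synchronous ∧ ∀ (i : Fin n) (r : I.Run), ∃ prior : PlausibilitySpace I.Run,
    ∀ m : ℕ, I.IsTimeProjection i r m prior

end InterpretedSystem

/-- Names of the conditions that may be imposed in addition. -/
inductive Condition
  | QUAL | NORM | REF | SDP | UNIF | RANK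

/-- The system satisfies the named condition. -/
def InterpretedSystem.Holds {n : ℕ} {Φ : Type v} (I : InterpretedSystem.{u, v} n Φ) :
    Condition → Prop
  | .QUAL => I.QUAL
  | .NORM => I.NORM
  | .REF => I.REF
  | .SDP => I.SDP
  | .UNIF => I.UNIF
  | .RANK => I.RANK

/-! Coherence and PERSIST do not make the ordering at time `m + 1` a conditioning of the ordering at
time `m`: they only control implausible sets and the identity of spaces. So the space of each time
is given its own layer of runs. A run of the new system is a run of `I` with a lifetime in `ℕ∞`, and
at time `k` an agent sees `min life k`, that is, only whether the lifetime has ended and when.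

The prior at `r` is a lexicographic sum. For each finite `l` and each run `s` with the same initial
local state and space as `r`, it has a copy of the space at `(s, l)` on the runs of lifetime `l`;
smaller `l` take precedence. While the lifetime of the actual run is at least `k`, conditioning at
time `k` removes the layers below `k`, so layer `k` decides. By PERSIST and perfect recall all its
surviving components are copies of the space at the actual point. By coherence, what is implausible
there is implausible in all later layers, so these never overrule it
(`tagged_val_le_iff_of_le_life`). Hence formulas without `next` keep their truth value up to the end
of the lifetime, and runs of infinite lifetime serve as the images of the runs of `I`.

REF requires such a run to be plausible for itself, so a point mass is added at infinite lifetime.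
It is added only over runs on which REF already holds, so that it makes no implausible set
plausible. QUAL and RANK survive lexicographic sums, images and conditioning. -/

namespace PlausibilitySpace

/-! ### Plausibility of arbitrary sets -/

variable {W V : Type u}

/-- The plausibility of the part of an arbitrary set that lies in the carrier. -/
def val (S : PlausibilitySpace W) (A : Set W) : S.D := S.Pl (A ∩ S.carrier)

theorem val_of_subset (S : PlausibilitySpace W) {A : Set W} (h : A ⊆ S.carrier) :
    S.val A = S.Pl A := by
  rw [val, Set.inter_eq_left.2 h]

theorem val_mono (S : PlausibilitySpace W) {A B : Set W} (h : A ⊆ B) : S.val A ≤ S.val B :=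
  S.mono _ _ (Set.inter_subset_inter_left _ h) Set.inter_subset_right

theorem val_empty (S : PlausibilitySpace W) : S.val ∅ = ⊥ := by
  rw [val, Set.empty_inter, S.Pl_empty]

theorem val_carrier (S : PlausibilitySpace W) : S.val S.carrier = ⊤ := by
  rw [val, Set.inter_self, S.Pl_carrier]

theorem val_univ (S : PlausibilitySpace W) : S.val Set.univ = ⊤ := by
  rw [val, Set.univ_inter, S.Pl_carrier]

theorem val_congr (S : PlausibilitySpace W) {A B : Set W}
    (h : ∀ x ∈ S.carrier, x ∈ A ↔ x ∈ B) : S.val A = S.val B := by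
  unfold val
  congr 1
  ext x
  exact ⟨fun hx => ⟨(h x hx.2).1 hx.1, hx.2⟩, fun hx => ⟨(h x hx.2).2 hx.1, hx.2⟩⟩

theorem val_eq_bot_iff (S : PlausibilitySpace W) {A : Set W} :
    S.val A = ⊥ ↔ S.val A ≤ S.val ∅ := by
  rw [S.val_empty, le_bot_iff]

theorem Same.refl (S : PlausibilitySpace W) : S.Same S := ⟨rfl, fun _ _ _ _ => Iff.rfl⟩

theorem Same.symm {S T : PlausibilitySpace W} (h : S.Same T) : T.Same S :=
  ⟨h.1.symm, fun A B hA hB => (h.2 A B (h.1 ▸ hA) (h.1 ▸ hB)).symm⟩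

theorem Same.trans {S T U : PlausibilitySpace W} (h : S.Same T) (h' : T.Same U) : S.Same U :=
  ⟨h.1.trans h'.1, fun A B hA hB =>
    (h.2 A B hA hB).trans (h'.2 A B (h.1 ▸ hA) (h.1 ▸ hB))⟩

theorem Same.val_le_iff {S T : PlausibilitySpace W} (h : S.Same T) (A B : Set W) :
    S.val A ≤ S.val B ↔ T.val A ≤ T.val B := by
  unfold val
  rw [← h.1]
  exact h.2 _ _ Set.inter_subset_right Set.inter_subset_right

theorem Same.val_eq_bot_iff {S T : PlausibilitySpace W} (h : S.Same T) (A : Set W) :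
    S.val A = ⊥ ↔ T.val A = ⊥ := by
  rw [S.val_eq_bot_iff, T.val_eq_bot_iff, h.val_le_iff]

/-- Axioms A2 and A3 for arbitrary sets, in terms of `val`. -/
theorem qualitative_iff_val (S : PlausibilitySpace W) :
    S.Qualitative ↔
      (∀ A B C : Set W, Disjoint A B → Disjoint A C → Disjoint B C →
        S.val C < S.val (A ∪ B) → S.val B < S.val (A ∪ C) → S.val (B ∪ C) < S.val A) ∧
      (∀ A B : Set W, S.val A = ⊥ → S.val B = ⊥ → S.val (A ∪ B) = ⊥) := by
  constructor
  · rintro ⟨h2, h3⟩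
    refine ⟨fun A B C hAB hAC hBC h h' => ?_, fun A B h h' => ?_⟩
    · simp only [val, Set.union_inter_distrib_right] at *
      exact h2 _ _ _ Set.inter_subset_right Set.inter_subset_right Set.inter_subset_right
        (hAB.mono Set.inter_subset_left Set.inter_subset_left)
        (hAC.mono Set.inter_subset_left Set.inter_subset_left)
        (hBC.mono Set.inter_subset_left Set.inter_subset_left) h h'
    · simp only [val, Set.union_inter_distrib_right] at *
      exact h3 _ _ Set.inter_subset_right Set.inter_subset_right h h'
  · rintro ⟨h2, h3⟩
    refine ⟨fun A B C hA hB hC hAB hAC hBC h h' => ?_, fun A B hA hB h h' => ?_⟩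
    · rw [← S.val_of_subset hA, ← S.val_of_subset (Set.union_subset hB hC)]
      rw [← S.val_of_subset hC, ← S.val_of_subset (Set.union_subset hA hB)] at h
      rw [← S.val_of_subset hB, ← S.val_of_subset (Set.union_subset hA hC)] at h'
      exact h2 A B C hAB hAC hBC h h'
    · rw [← S.val_of_subset (Set.union_subset hA hB)]
      rw [← S.val_of_subset hA] at h
      rw [← S.val_of_subset hB] at h'
      exact h3 A B h h'

/-- Monotonicity supplies the other half of the maximum condition, so two inequalities suffice. -/
theorem isRanking_iff_val (S : PlausibilitySpace W) :
    S.IsRanking ↔ ∀ A B : Set W, (S.val A ≤ S.val B ∨ S.val B ≤ S.val A) ∧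
      (S.val (A ∪ B) ≤ S.val A ∨ S.val (A ∪ B) ≤ S.val B) := by
  constructor
  · intro h A B
    simp only [val, Set.union_inter_distrib_right]
    obtain ⟨h1, h2, -⟩ := h (A ∩ S.carrier) (B ∩ S.carrier) Set.inter_subset_right
      Set.inter_subset_right
    exact ⟨h1, h2.imp le_of_eq le_of_eq⟩
  · intro h A B hA hB
    have h' := h A B
    have hl := S.val_mono (Set.subset_union_left : A ⊆ A ∪ B)
    have hr := S.val_mono (Set.subset_union_right : B ⊆ A ∪ B)
    rw [S.val_of_subset hA, S.val_of_subset (Set.union_subset hA hB)] at *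
    rw [S.val_of_subset hB] at *
    refine ⟨h'.1, h'.2.imp (fun e => le_antisymm e hl) (fun e => le_antisymm e hr), ?_⟩
    rintro x (rfl | rfl)
    exacts [hl, hr]

/-! ### Transfer of QUAL and RANK along maps of sets -/

section transfer

variable {S : PlausibilitySpace W} {T : PlausibilitySpace V} {g : Set V → Set W}

theorem val_eq_bot_iff_of_le_iff (h0 : g ∅ = ∅)
    (hle : ∀ A B, T.val A ≤ T.val B ↔ S.val (g A) ≤ S.val (g B)) (A : Set V) :
    T.val A = ⊥ ↔ S.val (g A) = ⊥ := by
  rw [T.val_eq_bot_iff, S.val_eq_bot_iff, hle, h0]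

theorem val_lt_iff_of_le_iff
    (hle : ∀ A B, T.val A ≤ T.val B ↔ S.val (g A) ≤ S.val (g B)) (A B : Set V) :
    T.val A < T.val B ↔ S.val (g A) < S.val (g B) := by
  rw [lt_iff_le_not_ge, lt_iff_le_not_ge, hle, hle]

/-- A2 and A3 mention only unions, disjointness, `⊥` and the order. The maps `g` of interest are
intersection with a fixed set (conditioning) and preimage (image spaces). -/
theorem Qualitative.transfer (hS : S.Qualitative) (h0 : g ∅ = ∅)
    (hun : ∀ A B, g (A ∪ B) = g A ∪ g B) (hdj : ∀ A B, Disjoint A B → Disjoint (g A) (g B))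
    (hle : ∀ A B, T.val A ≤ T.val B ↔ S.val (g A) ≤ S.val (g B)) : T.Qualitative := by
  rw [qualitative_iff_val] at hS ⊢
  simp only [val_lt_iff_of_le_iff hle, val_eq_bot_iff_of_le_iff h0 hle, hun]
  exact ⟨fun A B C hAB hAC hBC => hS.1 _ _ _ (hdj _ _ hAB) (hdj _ _ hAC) (hdj _ _ hBC),
    fun A B => hS.2 _ _⟩

theorem IsRanking.transfer (hS : S.IsRanking) (hun : ∀ A B, g (A ∪ B) = g A ∪ g B)
    (hle : ∀ A B, T.val A ≤ T.val B ↔ S.val (g A) ≤ S.val (g B)) : T.IsRanking := by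
  rw [isRanking_iff_val] at hS ⊢
  simp only [hle, hun]
  exact fun A B => hS _ _

end transfer

theorem proj_val_le_iff (S : PlausibilitySpace W) (E A B : Set W) :
    (S.proj E).val A ≤ (S.proj E).val B ↔ S.val (A ∩ E) ≤ S.val (B ∩ E) := by
  have key : ∀ A : Set W, A ∩ (S.carrier ∩ E) ∩ (S.carrier ∩ E) = A ∩ E ∩ S.carrier := by
    intro A
    ext x
    simp only [Set.mem_inter_iff]
    tauto
  change S.Pl (A ∩ (S.carrier ∩ E) ∩ (S.carrier ∩ E)) ≤
    S.Pl (B ∩ (S.carrier ∩ E) ∩ (S.carrier ∩ E)) ↔ _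
  rw [key, key]
  rfl

theorem Qualitative.proj {S : PlausibilitySpace W} (h : S.Qualitative) (E : Set W) :
    (S.proj E).Qualitative :=
  h.transfer (g := fun A => A ∩ E) (Set.empty_inter _)
    (fun A B => Set.union_inter_distrib_right A B E)
    (fun _ _ hd => hd.mono Set.inter_subset_left Set.inter_subset_left) (S.proj_val_le_iff E)

theorem IsRanking.proj {S : PlausibilitySpace W} (h : S.IsRanking) (E : Set W) :
    (S.proj E).IsRanking :=
  h.transfer (g := fun A => A ∩ E) (fun A B => Set.union_inter_distrib_right A B E)
    (S.proj_val_le_iff E)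

/-- The image of a plausibility space under a function. -/
def map (h : W → V) (S : PlausibilitySpace W) : PlausibilitySpace V where
  carrier := h '' S.carrier
  D := S.D
  Pl := fun A => S.val (h ⁻¹' A)
  Pl_empty := S.val_empty
  Pl_carrier := by
    rw [← S.val_carrier]
    exact S.val_congr fun x hx => ⟨fun _ => hx, fun _ => ⟨x, hx, rfl⟩⟩
  mono := fun _ _ hAB _ => S.val_mono (Set.preimage_mono hAB)

theorem map_val (h : W → V) (S : PlausibilitySpace W) (A : Set V) :
    (S.map h).val A = S.val (h ⁻¹' A) :=
  S.val_congr fun x hx => ⟨fun hA => hA.1, fun hA => ⟨hA, x, hx, rfl⟩⟩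

theorem map_val_le_iff (h : W → V) (S : PlausibilitySpace W) (A B : Set V) :
    (S.map h).val A ≤ (S.map h).val B ↔ S.val (h ⁻¹' A) ≤ S.val (h ⁻¹' B) := by
  rw [map_val, map_val]
  rfl

theorem map_val_eq_bot_iff (h : W → V) (S : PlausibilitySpace W) (A : Set V) :
    (S.map h).val A = ⊥ ↔ S.val (h ⁻¹' A) = ⊥ :=
  val_eq_bot_iff_of_le_iff (g := fun A => h ⁻¹' A) rfl (map_val_le_iff h S) A

theorem Qualitative.map {S : PlausibilitySpace W} (hS : S.Qualitative) (h : W → V) :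
    (S.map h).Qualitative :=
  hS.transfer (g := fun A => h ⁻¹' A) rfl (fun _ _ => rfl) (fun _ _ hd => hd.preimage h)
    (map_val_le_iff h S)

theorem IsRanking.map {S : PlausibilitySpace W} (hS : S.IsRanking) (h : W → V) :
    (S.map h).IsRanking :=
  hS.transfer (g := fun A => h ⁻¹' A) (fun _ _ => rfl) (map_val_le_iff h S)

/-! ### Spaces defined by a relation on sets, and point masses -/

/-- The plausibility space given by a reflexive and transitive relation on sets that extends
inclusion: the value of a set is the collection of the sets below it. -/
def ofRel (C : Set W) (le : Set W → Set W → Prop)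
    (htrans : ∀ A B C, le A B → le B C → le A C) (hmono : ∀ A B, A ⊆ B → le A B)
    (hinter : ∀ A, le A (A ∩ C)) : PlausibilitySpace W where
  carrier := C
  D := Set.Icc {X | le X ∅} {X | le X Set.univ}
  bounded :=
    { top := ⟨{X | le X Set.univ}, fun _ h => htrans _ _ _ h (hmono _ _ (Set.empty_subset _)),
        le_refl _⟩
      le_top := fun a => a.2.2
      bot := ⟨{X | le X ∅}, le_refl _,
        fun _ h => htrans _ _ _ h (hmono _ _ (Set.empty_subset _))⟩
      bot_le := fun a => a.2.1 }
  Pl := fun A => ⟨{X | le X A}, fun _ h => htrans _ _ _ h (hmono _ _ (Set.empty_subset _)),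
    fun _ h => htrans _ _ _ h (hmono _ _ (Set.subset_univ _))⟩
  Pl_empty := rfl
  Pl_carrier := Subtype.ext (Set.ext fun _ =>
    ⟨fun h => htrans _ _ _ h (hmono _ _ (Set.subset_univ _)),
      fun h => htrans _ _ _ h ((Set.univ_inter C) ▸ hinter Set.univ)⟩)
  mono := fun _ _ h _ _ hX => htrans _ _ _ hX (hmono _ _ h)

theorem ofRel_val_le_iff {C : Set W} {le : Set W → Set W → Prop}
    {htrans : ∀ A B C, le A B → le B C → le A C} {hmono : ∀ A B, A ⊆ B → le A B}
    {hinter : ∀ A, le A (A ∩ C)} (A B : Set W) :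
    (ofRel C le htrans hmono hinter).val A ≤ (ofRel C le htrans hmono hinter).val B ↔ le A B := by
  constructor
  · intro h
    exact htrans _ _ _ (h (hinter A)) (hmono _ _ Set.inter_subset_left)
  · intro h X hX
    exact htrans _ _ _ hX (htrans _ _ _ (hmono _ _ Set.inter_subset_left)
      (htrans _ _ _ h (hinter B)))

/-- The plausibility space concentrated on one point. -/
def dirac (x : W) : PlausibilitySpace W :=
  ofRel {x} (fun A B => x ∈ A → x ∈ B) (fun _ _ _ h h' hx => h' (h hx)) (fun _ _ h hx => h hx)
    (fun _ hx => ⟨hx, rfl⟩)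

theorem dirac_val_le_iff (x : W) (A B : Set W) :
    (dirac x).val A ≤ (dirac x).val B ↔ (x ∈ A → x ∈ B) :=
  ofRel_val_le_iff A B

theorem dirac_val_eq_bot_iff (x : W) (A : Set W) : (dirac x).val A = ⊥ ↔ x ∉ A := by
  rw [val_eq_bot_iff, dirac_val_le_iff]
  rfl

theorem dirac_qualitative (x : W) : (dirac x).Qualitative := by
  rw [qualitative_iff_val]
  simp only [lt_iff_le_not_ge, dirac_val_le_iff, dirac_val_eq_bot_iff, Set.mem_union]
  refine ⟨fun A B C hAB hAC hBC => ?_, fun A B => by tauto⟩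
  have h : ¬(x ∈ B ∧ x ∈ C) := fun h => Set.disjoint_left.1 hBC h.1 h.2
  have h' : ¬(x ∈ A ∧ x ∈ B) := fun h => Set.disjoint_left.1 hAB h.1 h.2
  have h'' : ¬(x ∈ A ∧ x ∈ C) := fun h => Set.disjoint_left.1 hAC h.1 h.2
  tauto

theorem dirac_isRanking (x : W) : (dirac x).IsRanking := by
  rw [isRanking_iff_val]
  simp only [dirac_val_le_iff, Set.mem_union]
  intro A B
  tauto

/-! ### Lexicographic sums -/

section lexSum

variable {ι : Type*} (lt : ι → ι → Prop) (S : ι → PlausibilitySpace W) (J : Set ι)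

/-- The sets `A` and `B` are compared at the first index in `J` at which one of them is
plausible. -/
def LexLE (A B : Set W) : Prop :=
  (∀ j ∈ J, (S j).val A = ⊥) ∨
    ∃ j ∈ J, (∀ i ∈ J, lt i j → (S i).val A = ⊥ ∧ (S i).val B = ⊥) ∧
      (S j).val B ≠ ⊥ ∧ (S j).val A ≤ (S j).val B

variable {S J}

theorem exists_first_plausible [IsWellOrder ι lt] {A : Set W}
    (h : ¬∀ j ∈ J, (S j).val A = ⊥) :
    ∃ j ∈ J, (S j).val A ≠ ⊥ ∧ ∀ i ∈ J, lt i j → (S i).val A = ⊥ := by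
  push Not at h
  obtain ⟨j, ⟨hj, hA⟩, hmin⟩ := (IsWellFounded.wf (r := lt)).has_min
    {j | j ∈ J ∧ (S j).val A ≠ ⊥} h
  refine ⟨j, hj, hA, fun i hi hij => ?_⟩
  by_contra hne
  exact hmin i ⟨hi, hne⟩ hij

variable {lt}

theorem val_eq_bot_of_subset (T : PlausibilitySpace W) {A B : Set W} (h : A ⊆ B)
    (hB : T.val B = ⊥) : T.val A = ⊥ :=
  le_bot_iff.1 (hB ▸ T.val_mono h)

theorem LexLE.of_subset [IsWellOrder ι lt] {A B : Set W} (h : A ⊆ B) : LexLE lt S J A B := by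
  by_cases hB : ∀ j ∈ J, (S j).val B = ⊥
  · exact Or.inl fun j hj => val_eq_bot_of_subset _ h (hB j hj)
  · obtain ⟨j, hj, hne, hmin⟩ := exists_first_plausible lt hB
    exact Or.inr ⟨j, hj, fun i hi hij =>
      ⟨val_eq_bot_of_subset _ h (hmin i hi hij), hmin i hi hij⟩, hne, (S j).val_mono h⟩

theorem LexLE.trans [IsWellOrder ι lt] {A B C : Set W} (h : LexLE lt S J A B)
    (h' : LexLE lt S J B C) : LexLE lt S J A C := by
  rcases h with h | ⟨j, hj, hlt, hne, hle⟩
  · exact Or.inl h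
  rcases h' with h' | ⟨k, hk, hlt', hne', hle'⟩
  · exact absurd (h' j hj) hne
  rcases trichotomous_of lt j k with hjk | rfl | hjk
  · exact absurd (hlt' j hj hjk).1 hne
  · exact Or.inr ⟨j, hj, fun i hi hij => ⟨(hlt i hi hij).1, (hlt' i hi hij).2⟩, hne',
      hle.trans hle'⟩
  · refine Or.inr ⟨k, hk, fun i hi hik => ⟨?_, (hlt' i hi hik).2⟩, hne', ?_⟩
    · exact (hlt i hi (_root_.trans hik hjk)).1
    · rw [(hlt k hk hjk).1]
      exact bot_le

/-- If `A` and `B` are implausible before `j` and one of them is plausible at `j`, then they are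
compared at `j`. -/
theorem lexLE_iff [IsWellOrder ι lt] {A B : Set W} {j : ι} (hj : j ∈ J)
    (hlt : ∀ i ∈ J, lt i j → (S i).val A = ⊥ ∧ (S i).val B = ⊥)
    (hne : (S j).val A ≠ ⊥ ∨ (S j).val B ≠ ⊥) :
    LexLE lt S J A B ↔ (S j).val A ≤ (S j).val B := by
  constructor
  · rintro (h | ⟨k, hk, hlt', hne', hle⟩)
    · rw [h j hj]
      exact bot_le
    · rcases trichotomous_of lt j k with hjk | rfl | hjk
      · have := hlt' j hj hjk
        tauto
      · exact hle
      · exact absurd (hlt k hk hjk).2 hne'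
  · intro hle
    refine Or.inr ⟨j, hj, hlt, fun hB => ?_, hle⟩
    rw [hB, le_bot_iff] at hle
    tauto

/-- If `A` is implausible at `j`, then by `hA` it is implausible throughout and both sides hold;
nothing is needed about `B` after `j`. Coherence will supply `hA`. -/
theorem lexLE_iff_of_eq_bot [IsWellOrder ι lt] {A B : Set W} {j : ι} (hj : j ∈ J)
    (hlt : ∀ i ∈ J, lt i j → (S i).val A = ⊥ ∧ (S i).val B = ⊥)
    (hA : (S j).val A = ⊥ → ∀ i ∈ J, (S i).val A = ⊥) :
    LexLE lt S J A B ↔ (S j).val A ≤ (S j).val B := by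
  by_cases h : (S j).val A = ⊥
  · rw [h]
    exact ⟨fun _ => bot_le, fun _ => Or.inl (hA h)⟩
  · exact lexLE_iff hj hlt (Or.inl h)

variable (lt S J)

/-- The lexicographic combination of the plausibility spaces `S j` with `j ∈ J`. -/
def lexSum [IsWellOrder ι lt] : PlausibilitySpace W :=
  ofRel {x | ∃ j ∈ J, x ∈ (S j).carrier} (LexLE lt S J) (fun _ _ _ h h' => h.trans h')
    (fun _ _ h => LexLE.of_subset h) (by
      intro A
      have key : ∀ j ∈ J, (S j).val (A ∩ {x | ∃ j ∈ J, x ∈ (S j).carrier}) = (S j).val A :=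
        fun j hj => (S j).val_congr fun x hx => ⟨fun h => h.1, fun h => ⟨h, j, hj, hx⟩⟩
      by_cases hA : ∀ j ∈ J, (S j).val A = ⊥
      · exact Or.inl hA
      · obtain ⟨j, hj, hne, hmin⟩ := exists_first_plausible lt hA
        refine (lexLE_iff hj (fun i hi hij => ?_) (Or.inl hne)).2 (key j hj).ge
        rw [key i hi]
        exact ⟨hmin i hi hij, hmin i hi hij⟩)

variable [IsWellOrder ι lt]

theorem lexSum_val_le_iff (A B : Set W) :
    (lexSum lt S J).val A ≤ (lexSum lt S J).val B ↔ LexLE lt S J A B :=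
  ofRel_val_le_iff A B

theorem lexSum_val_eq_bot_iff (A : Set W) :
    (lexSum lt S J).val A = ⊥ ↔ ∀ j ∈ J, (S j).val A = ⊥ := by
  rw [val_eq_bot_iff, lexSum_val_le_iff]
  exact ⟨fun h => h.elim id fun ⟨j, _, _, hne, _⟩ => absurd (S j).val_empty hne, Or.inl⟩

variable {lt S J}

/-- Each comparison in A2 is between two sets with union `A ∪ B ∪ C`. All of them are therefore
decided at the first index where this union is plausible, and A2 there applies. -/
theorem Qualitative.lexSum (h : ∀ j ∈ J, (S j).Qualitative) : (lexSum lt S J).Qualitative := by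
  simp only [qualitative_iff_val] at h ⊢
  refine ⟨fun A B C hAB hAC hBC hC hB => ?_, fun A B hA hB => ?_⟩
  · have hAU : A ⊆ A ∪ B ∪ C := fun x hx => Or.inl (Or.inl hx)
    have hBU : B ⊆ A ∪ B ∪ C := fun x hx => Or.inl (Or.inr hx)
    have hCU : C ⊆ A ∪ B ∪ C := fun x hx => Or.inr hx
    have hU : ¬∀ j ∈ J, (S j).val (A ∪ B ∪ C) = ⊥ := fun hU => by
      have : (PlausibilitySpace.lexSum lt S J).val (A ∪ B) = ⊥ :=
        (lexSum_val_eq_bot_iff lt S J _).2 fun j hj =>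
          val_eq_bot_of_subset _ Set.subset_union_left (hU j hj)
      rw [this] at hC
      exact not_lt_bot hC
    obtain ⟨j, hj, hne, hmin⟩ := exists_first_plausible lt hU
    have key : ∀ X Y, X ⊆ A ∪ B ∪ C → Y ⊆ A ∪ B ∪ C → X ∪ Y = A ∪ B ∪ C →
        ((PlausibilitySpace.lexSum lt S J).val X < (PlausibilitySpace.lexSum lt S J).val Y ↔
          (S j).val X < (S j).val Y) := by
      intro X Y hX hY hXY
      have hbot : ∀ Z ⊆ A ∪ B ∪ C, ∀ i ∈ J, lt i j → (S i).val Z = ⊥ :=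
        fun Z hZ i hi hij => val_eq_bot_of_subset _ hZ (hmin i hi hij)
      -- By A3 at `j`, two implausible sets cannot have a plausible union.
      have hor : (S j).val X ≠ ⊥ ∨ (S j).val Y ≠ ⊥ := by
        by_contra! hcon
        exact hne (hXY ▸ (h j hj).2 X Y hcon.1 hcon.2)
      rw [lt_iff_le_not_ge, lt_iff_le_not_ge, lexSum_val_le_iff, lexSum_val_le_iff,
        lexLE_iff hj (fun i hi hij => ⟨hbot X hX i hi hij, hbot Y hY i hi hij⟩) hor,
        lexLE_iff hj (fun i hi hij => ⟨hbot Y hY i hi hij, hbot X hX i hi hij⟩) hor.symm]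
    rw [key _ _ hCU (Set.union_subset hAU hBU) (Set.union_comm _ _)] at hC
    rw [key _ _ hBU (Set.union_subset hAU hCU) (by ext; simp only [Set.mem_union]; tauto)] at hB
    rw [key _ _ (Set.union_subset hBU hCU) hAU (by ext; simp only [Set.mem_union]; tauto)]
    exact (h j hj).1 A B C hAB hAC hBC hC hB
  · rw [lexSum_val_eq_bot_iff] at *
    exact fun j hj => (h j hj).2 A B (hA j hj) (hB j hj)

theorem IsRanking.lexSum (h : ∀ j ∈ J, (S j).IsRanking) : (lexSum lt S J).IsRanking := by
  simp only [isRanking_iff_val] at h ⊢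
  intro A B
  simp only [lexSum_val_le_iff]
  by_cases hU : ∀ j ∈ J, (S j).val (A ∪ B) = ⊥
  · exact ⟨Or.inl (Or.inl fun j hj => val_eq_bot_of_subset _ Set.subset_union_left (hU j hj)),
      Or.inl (Or.inl hU)⟩
  · obtain ⟨j, hj, hne, hmin⟩ := exists_first_plausible lt hU
    have hA : ∀ i ∈ J, lt i j → (S i).val A = ⊥ :=
      fun i hi hij => val_eq_bot_of_subset _ Set.subset_union_left (hmin i hi hij)
    have hB : ∀ i ∈ J, lt i j → (S i).val B = ⊥ :=
      fun i hi hij => val_eq_bot_of_subset _ Set.subset_union_right (hmin i hi hij)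
    have hor : (S j).val A ≠ ⊥ ∨ (S j).val B ≠ ⊥ := by
      by_contra! hcon
      rcases (h j hj A B).2 with h' | h' <;> simp_all
    rw [lexLE_iff hj (fun i hi hij => ⟨hA i hi hij, hB i hi hij⟩) hor,
      lexLE_iff hj (fun i hi hij => ⟨hB i hi hij, hA i hi hij⟩) hor.symm,
      lexLE_iff hj (fun i hi hij => ⟨hmin i hi hij, hA i hi hij⟩) (Or.inl hne),
      lexLE_iff hj (fun i hi hij => ⟨hmin i hi hij, hB i hi hij⟩) (Or.inl hne)]
    exact h j hj A B

end lexSum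

end PlausibilitySpace

namespace PlausibilitySpace

theorem Pl_sep {W : Type u} (S : PlausibilitySpace W) (P : W → Prop) :
    S.Pl {q | q ∈ S.carrier ∧ P q} = S.val {q | P q} := by
  rw [val, Set.inter_comm]
  rfl

end PlausibilitySpace

/-! ### Consequences of coherence, perfect recall and PERSIST over several steps -/

namespace InterpretedSystem

open PlausibilitySpace

variable {n : ℕ} {Φ : Type v} {I : InterpretedSystem.{u, v} n Φ}

theorem Coherent.val_eq_bot (hcoh : I.Coherent) (i : Fin n) (r : I.Run) (X : Set I.Run)
    {k l : ℕ} (hkl : k ≤ l) (h : (I.pl i (r, k)).val {q | q.1 ∈ X} = ⊥) :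
    (I.pl i (r, l)).val {q | q.1 ∈ X} = ⊥ := by
  induction l, hkl using Nat.le_induction with
  | base => exact h
  | succ l _ ih =>
    have key : ∀ O : Set I.Point,
        I.runsOf ({q | q.1 ∈ X} ∩ O) = X ∩ I.runsOf O := fun O => Set.ext fun s =>
      ⟨fun ⟨m, hX, hm⟩ => ⟨hX, m, hm⟩, fun ⟨hX, m, hm⟩ => ⟨m, hX, hm⟩⟩
    exact hcoh i r l X _ _ Set.inter_subset_right (key _) Set.inter_subset_right (key _) ih

theorem PerfectRecall.poss_of_le (hrec : I.PerfectRecall) {i : Fin n} {r s : I.Run} {k l : ℕ}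
    (hkl : k ≤ l) (h : (s, l) ∈ I.poss i (r, l)) : (s, k) ∈ I.poss i (r, k) := by
  induction l, hkl using Nat.le_induction with
  | base => exact h
  | succ l _ ih => exact ih (hrec i r s l h)

/-- Perfect recall keeps the two runs indistinguishable at all earlier times, so PERSIST can be
iterated down to time `0`. Thus a prior that depends only on initial data can serve all later times.
-/
theorem PERSIST.same_iff (hpers : I.PERSIST) (hrec : I.PerfectRecall) {i : Fin n} {r s : I.Run}
    {k : ℕ} (h : (s, k) ∈ I.poss i (r, k)) :
    (I.pl i (r, k)).Same (I.pl i (s, k)) ↔ (I.pl i (r, 0)).Same (I.pl i (s, 0)) := by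
  induction k with
  | zero => rfl
  | succ k ih => exact (hpers i r s k h).trans (ih (hrec i r s k h))

variable (I) in
/-- At time `0` agent `i` is in the same local state on the two runs and has the same plausibility
space. -/
def InitEquiv (i : Fin n) (r s : I.Run) : Prop :=
  (s, 0) ∈ I.poss i (r, 0) ∧ (I.pl i (r, 0)).Same (I.pl i (s, 0))

theorem InitEquiv.refl (i : Fin n) (r : I.Run) : I.InitEquiv i r r := ⟨rfl, Same.refl _⟩

theorem InitEquiv.symm {i : Fin n} {r s : I.Run} (h : I.InitEquiv i r s) : I.InitEquiv i s r :=
  ⟨Eq.symm h.1, h.2.symm⟩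

theorem InitEquiv.trans {i : Fin n} {r s t : I.Run} (h : I.InitEquiv i r s)
    (h' : I.InitEquiv i s t) : I.InitEquiv i r t :=
  ⟨Eq.trans h'.1 h.1, h.2.trans h'.2⟩

variable (I) in
/-- The condition REF for agent `i` at all points of the run `s`. -/
def ReflexiveOn (i : Fin n) (s : I.Run) : Prop :=
  ∀ k, (s, k) ∈ I.Om i (s, k) ∧ ∀ A : Set I.Point, (s, k) ∈ A → (I.pl i (s, k)).val A ≠ ⊥

theorem REF.reflexiveOn (h : I.REF) (i : Fin n) (s : I.Run) : I.ReflexiveOn i s := fun k =>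
  ⟨(h i (s, k)).1, fun _ hA =>
    ((h i (s, k)).2 _ Set.inter_subset_right ⟨hA, (h i (s, k)).1⟩).ne.symm⟩

/-! ### The tagged system

Each run of the tagged system is a run of `I` together with a lifetime in `ℕ∞`.  Up to the end of
the lifetime the agents do not observe it; afterwards they know it. -/

variable (I) in
/-- The run of the tagged system that belongs to a run of `I` and a lifetime. -/
noncomputable def taggedRun (x : I.Run × ℕ∞) :
    ℕ → ((I.Env × ∀ i, I.Loc i) × (I.Run × ℕ∞)) × (∀ i, I.Loc i × ℕ∞) :=
  fun k => ((x.1.1 k, x), fun i => ((x.1.1 k).2 i, min x.2 k))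

variable (I) in
abbrev TaggedRun : Type u := ↥(Set.range I.taggedRun)

namespace TaggedRun

noncomputable def tag (s : I.Run) (m : ℕ∞) : I.TaggedRun := ⟨I.taggedRun (s, m), (s, m), rfl⟩

/-- The environment state records the run and the lifetime at every time, so time `0` already
determines both. -/
def base (t : I.TaggedRun) : I.Run := (t.1 0).1.2.1

def life (t : I.TaggedRun) : ℕ∞ := (t.1 0).1.2.2

theorem life_tag (s : I.Run) (m : ℕ∞) : (tag s m).life = m := rfl

theorem tag_base_life (t : I.TaggedRun) : tag t.base t.life = t := by
  obtain ⟨_, x, rfl⟩ := t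
  rfl

theorem apply (t : I.TaggedRun) (k : ℕ) :
    t.1 k = ((t.base.1 k, (t.base, t.life)), fun i => ((t.base.1 k).2 i, min t.life k)) := by
  obtain ⟨_, x, rfl⟩ := t
  rfl

end TaggedRun

open TaggedRun

variable (I) in
/-- The runs of the tagged system that agent `i` cannot distinguish from `t` at time `k`. -/
def indist (i : Fin n) (t : I.TaggedRun) (k : ℕ) : Set I.TaggedRun :=
  {t' | (t'.base, k) ∈ I.poss i (t.base, k) ∧ min t'.life (k : ℕ∞) = min t.life k}

variable (I) in
/-- The component of the priors of agent `i` that belongs to a lifetime and a run. -/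
noncomputable def component (i : Fin n) (j : ℕ∞ × I.Run) : PlausibilitySpace I.TaggedRun :=
  ENat.recTopCoe (C := fun _ => PlausibilitySpace I.TaggedRun) (dirac (tag j.2 ⊤))
    (fun m => (I.pl i (j.2, m)).map fun q => tag q.1 m) j.1

theorem component_top (i : Fin n) (s : I.Run) :
    I.component i (⊤, s) = dirac (tag s ⊤) := rfl

variable (I) in
/-- The indices of the components of the prior of agent `i` at runs over `r`. -/
def indices (i : Fin n) (r : I.Run) : Set (ℕ∞ × I.Run) :=
  {j | I.InitEquiv i r j.2 ∧ (j.1 = ⊤ → I.ReflexiveOn i j.2)}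

theorem indices_congr {i : Fin n} {r s : I.Run} (h : I.InitEquiv i r s) :
    I.indices i r = I.indices i s :=
  Set.ext fun _ => and_congr_left fun _ => ⟨h.symm.trans, h.trans⟩

variable (I) in
/-- Indices are ordered by lifetime, and then by a well-order of the runs. -/
abbrev indexLT : ℕ∞ × I.Run → ℕ∞ × I.Run → Prop := Prod.Lex (· < ·) WellOrderingRel

variable (I) in
/-- The prior of agent `i` at runs of the tagged system that lie over `r`. -/
noncomputable def prior (i : Fin n) (r : I.Run) : PlausibilitySpace I.TaggedRun :=
  lexSum I.indexLT (I.component i) (I.indices i r)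

theorem prior_congr {i : Fin n} {r s : I.Run} (h : I.InitEquiv i r s) :
    I.prior i r = I.prior i s := by
  rw [prior, prior, indices_congr h]

variable (I) in
/-- The tagged system. -/
noncomputable abbrev tagged : InterpretedSystem.{u, v} n Φ where
  Env := (I.Env × ∀ i, I.Loc i) × (I.Run × ℕ∞)
  Loc := fun i => I.Loc i × ℕ∞
  runs := Set.range I.taggedRun
  val := fun g => I.val g.1.1
  pl := fun i p => ((I.prior i (base p.1)).proj (I.indist i p.1 p.2)).map fun t => (t, p.2)

/-! ### Synchrony, perfect recall and PRIOR for the tagged system -/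

theorem mem_tagged_poss (i : Fin n) (t t' : I.TaggedRun) (k k' : ℕ) :
    (t', k') ∈ I.tagged.poss i (t, k) ↔
      (t'.base, k') ∈ I.poss i (t.base, k) ∧ min t'.life (k' : ℕ∞) = min t.life k := by
  change (t'.1 k').2 i = (t.1 k).2 i ↔ _
  rw [t.apply, t'.apply]
  exact Prod.ext_iff

theorem tagged_synchronous (hsync : I.Synchronous) : I.tagged.Synchronous :=
  fun i ((t : I.TaggedRun), k) ((t' : I.TaggedRun), k') h =>
    hsync i (t.base, k) (t'.base, k')
    ((mem_tagged_poss i t t' k k').1 h).1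

theorem runsOf_tagged_poss (hsync : I.Synchronous) (i : Fin n) (t : I.TaggedRun) (k : ℕ) :
    I.tagged.runsOf (I.tagged.poss i (t, k)) = I.indist i t k := by
  ext t'
  constructor
  · rintro ⟨m, hm⟩
    obtain rfl : k = m := tagged_synchronous hsync i _ _ hm
    exact (mem_tagged_poss i t t' k k).1 hm
  · exact fun h => ⟨k, (mem_tagged_poss i t t' k k).2 h⟩

theorem tagged_perfectRecall (hrec : I.PerfectRecall) : I.tagged.PerfectRecall := by
  intro i (t : I.TaggedRun) (t' : I.TaggedRun) m h
  rw [mem_tagged_poss] at h ⊢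
  -- The lifetime as seen at time `m` is a function of what is seen at time `m + 1`.
  have key : ∀ x : ℕ∞, min x (m : ℕ∞) = min (min x ((m + 1 : ℕ) : ℕ∞)) m := fun x => by
    rw [min_assoc, min_eq_right (a := ((m + 1 : ℕ) : ℕ∞)) (by exact_mod_cast m.le_succ)]
  exact ⟨hrec i _ _ m h.1, by rw [key t'.life, h.2, ← key]⟩

theorem mem_tagged_Om (i : Fin n) (t : I.TaggedRun) (k : ℕ) (q : I.TaggedRun × ℕ) :
    q ∈ I.tagged.Om i (t, k) ↔
      q.1 ∈ (I.prior i t.base).carrier ∧ q.1 ∈ I.indist i t k ∧ q.2 = k := by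
  constructor
  · rintro ⟨t', ⟨h, h'⟩, rfl⟩
    exact ⟨h, h', rfl⟩
  · rintro ⟨h, h', rfl⟩
    exact ⟨q.1, ⟨h, h'⟩, rfl⟩

theorem tagged_prior (hsync : I.Synchronous) : I.tagged.PRIOR := by
  refine ⟨tagged_synchronous hsync, fun i (t : I.TaggedRun) =>
    ⟨I.prior i t.base, fun k => ⟨?_, ?_⟩⟩⟩
  · ext ⟨(t' : I.TaggedRun), k'⟩
    rw [mem_tagged_Om]
    constructor
    · rintro ⟨h, h', rfl⟩
      exact ⟨(mem_tagged_poss i t t' _ _).2 h', rfl, h⟩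
    · rintro ⟨h, rfl, h'⟩
      exact ⟨h', (mem_tagged_poss i t t' _ _).1 h, rfl⟩
  · intro A B hA hB
    rw [runsOf_tagged_poss hsync]
    have key : ∀ A : Set I.tagged.Point, A ⊆ I.tagged.Om i (t, k) →
        (I.tagged.pl i (t, k)).Pl A =
          ((I.prior i t.base).proj (I.indist i t k)).Pl (I.tagged.runsOf A) := by
      intro A hA
      change ((I.prior i t.base).proj (I.indist i t k)).val ((fun s => (s, k)) ⁻¹' A) = _
      rw [← val_of_subset]
      · refine val_congr _ fun s _ => ⟨fun h => ⟨k, h⟩, ?_⟩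
        rintro ⟨m, hm⟩
        obtain rfl : m = k := ((mem_tagged_Om i t k _).1 (hA hm)).2.2
        exact hm
      · rintro s ⟨m, hm⟩
        have := (mem_tagged_Om i t k _).1 (hA hm)
        exact ⟨this.1, this.2.1⟩
    rw [key A hA, key B hB]
    rfl

theorem tagged_val_le_iff (i : Fin n) (t : I.TaggedRun) (k : ℕ) (A B : Set (I.TaggedRun × ℕ)) :
    (I.tagged.pl i (t, k)).val A ≤ (I.tagged.pl i (t, k)).val B ↔
      (I.prior i t.base).val {s | (s, k) ∈ A ∧ s ∈ I.indist i t k} ≤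
        (I.prior i t.base).val {s | (s, k) ∈ B ∧ s ∈ I.indist i t k} :=
  (map_val_le_iff _ _ A B).trans (proj_val_le_iff _ _ _ _)

theorem tagged_val_eq_bot_iff (i : Fin n) (t : I.TaggedRun) (k : ℕ)
    (A : Set (I.TaggedRun × ℕ)) :
    (I.tagged.pl i (t, k)).val A = ⊥ ↔
      ∀ j ∈ I.indices i t.base, (I.component i j).val {s | (s, k) ∈ A ∧ s ∈ I.indist i t k} = ⊥ :=
  (val_eq_bot_iff_of_le_iff (g := fun A => {s | (s, k) ∈ A ∧ s ∈ I.indist i t k})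
    (Set.empty_inter _) (tagged_val_le_iff i t k) A).trans (lexSum_val_eq_bot_iff _ _ _ _)

/-! ### Preservation of the additional conditions -/

theorem tagged_qual (h : I.QUAL) : I.tagged.QUAL := by
  refine fun i p => ((Qualitative.lexSum ?_).proj _).map _
  rintro ⟨m, s⟩ -
  induction m using ENat.recTopCoe with
  | top => exact dirac_qualitative _
  | coe m => exact (h i (s, m)).map _

theorem tagged_rank (h : I.RANK) : I.tagged.RANK := by
  refine fun i p => ((IsRanking.lexSum ?_).proj _).map _
  rintro ⟨m, s⟩ -
  induction m using ENat.recTopCoe with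
  | top => exact dirac_isRanking _
  | coe m => exact (h i (s, m)).map _

theorem indist_congr {i : Fin n} {t t' : I.TaggedRun} {k : ℕ} (h : t' ∈ I.indist i t k) :
    I.indist i t k = I.indist i t' k :=
  Set.ext fun _ => and_congr ⟨fun h' => Eq.trans h' h.1.symm, fun h' => Eq.trans h' h.1⟩
    ⟨fun h' => h'.trans h.2.symm, fun h' => h'.trans h.2⟩

theorem tagged_pl_congr {i : Fin n} {t t' : I.TaggedRun} {k : ℕ} (h : t' ∈ I.indist i t k)
    (h' : I.InitEquiv i t.base t'.base) : I.tagged.pl i (t, k) = I.tagged.pl i (t', k) := by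
  change ((I.prior i t.base).proj (I.indist i t k)).map _ =
    ((I.prior i t'.base).proj (I.indist i t' k)).map _
  rw [prior_congr h', indist_congr h]

theorem tagged_sdp (hsync : I.Synchronous) (hrec : I.PerfectRecall) (h : I.SDP) :
    I.tagged.SDP := by
  rintro i ⟨(t : I.TaggedRun), k⟩ ⟨(t' : I.TaggedRun), k'⟩ hq
  obtain rfl : k = k' := tagged_synchronous hsync i _ _ hq
  rw [mem_tagged_poss] at hq
  have h0 := hrec.poss_of_le k.zero_le hq.1
  rw [tagged_pl_congr hq ⟨h0, h i _ _ h0⟩]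
  exact Same.refl _

/-- A run in the carrier of the prior comes from a component over some `s`. In a point mass its base
is `s`; in a finite layer `m`, UNIF at `(s, m)` equates the spaces of `s` and the base at time `m`,
and PERSIST carries this back to time `0`. So the two points have the same prior. -/
theorem tagged_unif (hsync : I.Synchronous) (hrec : I.PerfectRecall) (hcons : I.CONS)
    (hpers : I.PERSIST) (h : I.UNIF) : I.tagged.UNIF := by
  rintro i ⟨(t : I.TaggedRun), k⟩ ⟨(t' : I.TaggedRun), k'⟩ hq
  rw [mem_tagged_Om] at hq
  obtain ⟨⟨⟨m, s⟩, hj, hm⟩, hq, rfl⟩ := hq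
  have : I.InitEquiv i s t'.base := by
    induction m using ENat.recTopCoe with
    | top =>
      obtain rfl : t' = tag s ⊤ := hm
      exact .refl i s
    | coe m =>
      obtain ⟨⟨s', m'⟩, hO, rfl⟩ := hm
      obtain rfl : m = m' := hsync i _ _ (hcons i _ hO)
      have hp := hcons i _ hO
      exact ⟨hrec.poss_of_le m.zero_le hp, (hpers.same_iff hrec hp).1 (h i _ _ hO)⟩
  rw [tagged_pl_congr hq (hj.1.trans this)]
  exact Same.refl _

theorem component_coe_val_eq_bot_iff (i : Fin n) (m : ℕ) (s : I.Run) (A : Set I.TaggedRun) :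
    (I.component i (m, s)).val A = ⊥ ↔ (I.pl i (s, m)).val {q | tag q.1 m ∈ A} = ⊥ :=
  map_val_eq_bot_iff _ _ A

/-- If conditioning at time `k` left only implausible sets, then in the component over the base of
`t`, in layer `min life k`, the runs possible at time `k` would be implausible. Coherence carries
this to time `k`, where by CONS these runs make up the whole space, against NORM. -/
theorem tagged_norm (hcoh : I.Coherent) (hcons : I.CONS) (hsync : I.Synchronous)
    (h : I.NORM) : I.tagged.NORM := by
  rintro i ⟨(t : I.TaggedRun), k⟩
  rw [bot_lt_iff_ne_bot, ← val_univ, Ne, tagged_val_eq_bot_iff]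
  intro hbot
  obtain ⟨l, hl⟩ : ∃ l : ℕ, (l : ℕ∞) = min t.life k :=
    ENat.ne_top_iff_exists.1 (ne_top_of_le_ne_top (ENat.natCast_ne_top k) (min_le_right _ _))
  have hlk : l ≤ k := by exact_mod_cast hl.trans_le (min_le_right _ _)
  have hb := hbot (l, t.base) ⟨.refl i _, fun h => absurd h (ENat.natCast_ne_top l)⟩
  rw [component_coe_val_eq_bot_iff] at hb
  have hb' := hcoh.val_eq_bot i t.base {s | (s, k) ∈ I.poss i (t.base, k)} hlk (by
    rw [← hb]
    refine val_congr _ fun q _ => ⟨fun hq => ⟨trivial, hq, ?_⟩, fun hq => hq.2.1⟩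
    rw [life_tag, ← hl]
    exact min_eq_left (by exact_mod_cast hlk))
  · refine (h i (t.base, k)).ne ?_
    rw [← hb', ← val_carrier]
    refine val_congr _ fun q hq => ⟨fun _ => hq, fun _ => ?_⟩
    have hp := hcons i _ hq
    obtain rfl : k = q.2 := hsync i _ _ hp
    exact hp

/-- The component indexed by the lifetime and base of `t` itself makes `t` plausible: by REF in a
finite layer, as a point mass at infinite lifetime. -/
theorem tagged_ref (h : I.REF) : I.tagged.REF := by
  rintro i ⟨(t : I.TaggedRun), k⟩
  have hj : (t.life, t.base) ∈ I.indices i t.base := ⟨.refl i _, fun _ => h.reflexiveOn i _⟩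
  have hk : t ∈ I.indist i t k := ⟨rfl, rfl⟩
  refine ⟨(mem_tagged_Om i t k _).2 ⟨⟨_, hj, ?_⟩, hk, rfl⟩, fun A hA hp => ?_⟩
  · obtain ⟨s, m, rfl⟩ : ∃ s m, t = tag s m := ⟨_, _, t.tag_base_life.symm⟩
    induction m using ENat.recTopCoe with
    | top => exact Set.mem_singleton (tag s ⊤)
    | coe m => exact ⟨(s, m), (h i (s, m)).1, rfl⟩
  · rw [bot_lt_iff_ne_bot, ← val_of_subset _ hA, Ne, tagged_val_eq_bot_iff]
    intro hbot
    have hb := hbot _ hj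
    obtain ⟨s, m, rfl⟩ : ∃ s m, t = tag s m := ⟨_, _, t.tag_base_life.symm⟩
    induction m using ENat.recTopCoe with
    | top => exact (dirac_val_eq_bot_iff _ _).1 hb ⟨hp, hk⟩
    | coe m =>
      refine (h.reflexiveOn i s m).2 _ ?_ ((component_coe_val_eq_bot_iff i m s _).1 hb)
      exact ⟨hp, hk⟩

/-! ### Agreement with the original system during the lifetime -/

/-- Before the end of the lifetime of `t`, a component over a run that is indistinguishable from
`t` is unaffected by conditioning. -/
theorem val_preimage_indist (hsync : I.Synchronous) (hrec : I.PerfectRecall) (hcons : I.CONS)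
    {i : Fin n} {t : I.TaggedRun} {k l : ℕ} {s : I.Run} (hk : (k : ℕ∞) ≤ t.life) (hkl : k ≤ l)
    (hs : (s, k) ∈ I.poss i (t.base, k)) (X : Set I.Run) :
    (I.pl i (s, l)).val {q | tag q.1 l ∈ {t' | t'.base ∈ X ∧ t' ∈ I.indist i t k}} =
      (I.pl i (s, l)).val {q | q.1 ∈ X} := by
  refine val_congr _ fun ⟨s', l'⟩ hq => ⟨fun h => h.1, fun h => ⟨h, ?_, ?_⟩⟩
  · have hp := hcons i _ hq
    obtain rfl : l = l' := hsync i _ _ hp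
    exact Eq.trans (hrec.poss_of_le hkl hp) hs
  · rw [min_eq_right hk]
    exact min_eq_right (Nat.cast_le.2 hkl)

/-- Other components are excluded by conditioning. -/
theorem component_val_eq_bot (hsync : I.Synchronous) (hrec : I.PerfectRecall) (hcons : I.CONS)
    {i : Fin n} {t : I.TaggedRun} {k l : ℕ} {s : I.Run} (hk : (k : ℕ∞) ≤ t.life)
    (h : ¬(k ≤ l ∧ (s, k) ∈ I.poss i (t.base, k))) (X : Set I.Run) :
    (I.component i (l, s)).val {t' | t'.base ∈ X ∧ t' ∈ I.indist i t k} = ⊥ := by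
  rw [component_coe_val_eq_bot_iff, ← val_empty]
  refine val_congr _ fun ⟨s', l'⟩ hq => ⟨fun ⟨_, hsk, hl⟩ => h ?_, False.elim⟩
  have hp := hcons i _ hq
  obtain rfl : l = l' := hsync i _ _ hp
  rw [min_eq_right hk, life_tag, min_eq_right_iff] at hl
  have hkl : k ≤ l := by exact_mod_cast hl
  exact ⟨hkl, Eq.trans (Eq.symm (hrec.poss_of_le hkl hp)) hsk⟩

/-- On the sets of points that are determined by the run of `I`, the tagged system orders
plausibilities as `I` does, up to the end of the lifetime. -/
theorem tagged_val_le_iff_of_le_life (hcoh : I.Coherent) (hsync : I.Synchronous)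
    (hrec : I.PerfectRecall) (hcons : I.CONS) (hpers : I.PERSIST) (i : Fin n) (t : I.TaggedRun)
    {k : ℕ} (hk : (k : ℕ∞) ≤ t.life) (X Y : Set I.Run) :
    (I.tagged.pl i (t, k)).val {q | TaggedRun.base q.1 ∈ X} ≤
        (I.tagged.pl i (t, k)).val {q | TaggedRun.base q.1 ∈ Y} ↔
      (I.pl i (t.base, k)).val {q | q.1 ∈ X} ≤ (I.pl i (t.base, k)).val {q | q.1 ∈ Y} := by
  refine (tagged_val_le_iff i t k _ _).trans ((lexSum_val_le_iff _ _ _ _ _).trans ?_)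
  -- The index `(k, s₀)` is the first whose component survives conditioning, so it decides the
  -- comparison.
  obtain ⟨s₀, ⟨hs₀, hs₀k⟩, hmin⟩ := (IsWellFounded.wf (r := WellOrderingRel)).has_min
    {s | I.InitEquiv i t.base s ∧ (s, k) ∈ I.poss i (t.base, k)} ⟨t.base, .refl i _, rfl⟩
  have hj : ((k : ℕ∞), s₀) ∈ I.indices i t.base :=
    ⟨hs₀, fun h => absurd h (ENat.natCast_ne_top k)⟩
  have hsame : ∀ s, I.InitEquiv i t.base s → (s, k) ∈ I.poss i (t.base, k) →
      (I.pl i (t.base, k)).Same (I.pl i (s, k)) :=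
    fun s hs hsk => (hpers.same_iff hrec hsk).2 hs.2
  -- An earlier index has lifetime below `k`, which is excluded by what is seen at time `k`, or it
  -- lies in layer `k` over a run that is distinguishable from `t.base` at time `k`, by minimality
  -- of `s₀`.
  have hlt : ∀ j ∈ I.indices i t.base, I.indexLT j (k, s₀) → ∀ X : Set I.Run,
      (I.component i j).val {t' | t'.base ∈ X ∧ t' ∈ I.indist i t k} = ⊥ := by
    rintro ⟨l, s⟩ hls hlt
    rcases Prod.lex_def.1 hlt with hl | ⟨rfl, hl⟩
    · have hl : l < (k : ℕ∞) := hl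
      lift l to ℕ using hl.ne_top
      exact component_val_eq_bot hsync hrec hcons hk
        fun h => absurd h.1 (not_le.2 (by exact_mod_cast hl))
    · exact component_val_eq_bot hsync hrec hcons hk fun h => hmin s ⟨hls.1, h.2⟩ hl
  have hbot : (I.component i (k, s₀)).val {t' | t'.base ∈ X ∧ t' ∈ I.indist i t k} = ⊥ →
      ∀ j ∈ I.indices i t.base,
        (I.component i j).val {t' | t'.base ∈ X ∧ t' ∈ I.indist i t k} = ⊥ := by
    rintro h ⟨l, s⟩ hls
    rw [component_coe_val_eq_bot_iff, val_preimage_indist hsync hrec hcons hk le_rfl hs₀k,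
      ← (hsame s₀ hs₀ hs₀k).val_eq_bot_iff] at h
    induction l using ENat.recTopCoe with
    -- The point mass belongs to the prior only if REF holds along `s`; then a set containing `s` is
    -- plausible at `(s, k)`, whose space is that of `t.base`.
    | top =>
      rw [component_top, dirac_val_eq_bot_iff]
      rintro ⟨hX, hs, -⟩
      exact (hls.2 rfl k).2 {q | q.1 ∈ X} hX (((hsame s hls.1 hs).val_eq_bot_iff _).1 h)
    | coe l =>
      by_cases hl : k ≤ l ∧ (s, k) ∈ I.poss i (t.base, k)
      · rw [component_coe_val_eq_bot_iff, val_preimage_indist hsync hrec hcons hk hl.1 hl.2]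
        exact hcoh.val_eq_bot i s X hl.1 (((hsame s hls.1 hl.2).val_eq_bot_iff _).1 h)
      · exact component_val_eq_bot hsync hrec hcons hk hl X
  refine (lexLE_iff_of_eq_bot hj (fun j hj hjk => ⟨hlt j hj hjk X, hlt j hj hjk Y⟩) hbot).trans ?_
  rw [(hsame s₀ hs₀ hs₀k).val_le_iff,
    ← val_preimage_indist hsync hrec hcons hk le_rfl hs₀k X,
    ← val_preimage_indist hsync hrec hcons hk le_rfl hs₀k Y]
  exact map_val_le_iff _ _ _ _

/-- Without `next` the time stays at `k`, and a run indistinguishable from `t` at time `k` also has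
lifetime at least `k`. So the induction never leaves the lifetimes on which the two systems agree.
-/
theorem tagged_sat_iff_of_timeFree (hcoh : I.Coherent) (hsync : I.Synchronous)
    (hrec : I.PerfectRecall) (hcons : I.CONS) (hpers : I.PERSIST) (φ : Formula n Φ)
    (hφ : φ.TimeFree) (t : I.TaggedRun) (k : ℕ) (hk : (k : ℕ∞) ≤ t.life) :
    I.tagged.Sat (t, k) φ ↔ I.Sat (t.base, k) φ := by
  induction φ generalizing t with
  | prim a =>
    change I.val (t.1 k).1.1 a ↔ _
    rw [t.apply]
    rfl
  | neg φ ih => exact not_congr (ih hφ t hk)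
  | conj φ ψ ih ih' => exact and_congr (ih hφ.1 t hk) (ih' hφ.2 t hk)
  | know i φ ih =>
    constructor
    · rintro h ⟨s, k'⟩ hs
      obtain rfl : k = k' := hsync i _ _ hs
      -- Any lifetime from `k` on looks the same at time `k`; the infinite one serves for every `s`.
      refine (ih hφ (tag s ⊤) le_top).1 (h _ ((mem_tagged_poss _ _ _ _ _).2 ⟨hs, ?_⟩))
      rw [min_eq_right hk]
      exact min_eq_right le_top
    · rintro h ⟨(t' : I.TaggedRun), k'⟩ ht
      obtain rfl : k = k' := tagged_synchronous hsync i _ _ ht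
      rw [mem_tagged_poss, min_eq_right hk] at ht
      exact (ih hφ t' (min_eq_right_iff.1 ht.2)).2 (h _ ht.1)
  | cond i φ ψ ih ih' =>
    have key := tagged_val_le_iff_of_le_life hcoh hsync hrec hcons hpers i t hk
    have hS : ∀ P : I.Point → Prop,
        (I.pl i (t.base, k)).Pl {q | q ∈ I.Om i (t.base, k) ∧ P q} =
          (I.pl i (t.base, k)).val {q | q.1 ∈ {s | P (s, k)}} := by
      intro P
      rw [Om, Pl_sep]
      refine val_congr _ fun q hq => ?_
      have hk' : k = q.2 := hsync i _ _ (hcons i _ hq)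
      subst hk'
      rfl
    have hT : ∀ (P : I.Point → Prop) (Q : I.tagged.Point → Prop),
        (∀ t' : I.TaggedRun, (k : ℕ∞) ≤ t'.life → (Q (t', k) ↔ P (t'.base, k))) →
        (I.tagged.pl i (t, k)).Pl {q | q ∈ I.tagged.Om i (t, k) ∧ Q q} =
          (I.tagged.pl i (t, k)).val {q | TaggedRun.base q.1 ∈ {s | P (s, k)}} := by
      intro P Q hPQ
      rw [Om, Pl_sep]
      refine val_congr _ fun ⟨(t' : I.TaggedRun), k'⟩ hq => ?_
      obtain ⟨-, h, rfl⟩ := (mem_tagged_Om i t k _).1 hq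
      exact hPQ t' (min_eq_right_iff.1 (h.2.trans (min_eq_right hk)))
    simp only [Sat]
    rw [hS, hS, hS, hT (fun q => I.Sat q φ) _ fun t' ht => ih hφ.1 t' ht,
      hT (fun q => I.Sat q φ ∧ ¬I.Sat q ψ) _ fun t' ht =>
        and_congr (ih hφ.1 t' ht) (not_congr (ih' hφ.2 t' ht)),
      hT (fun q => I.Sat q φ ∧ I.Sat q ψ) _ fun t' ht =>
        and_congr (ih hφ.1 t' ht) (ih' hφ.2 t' ht)]
    refine or_congr ?_ ?_
    · rw [val_eq_bot_iff, val_eq_bot_iff]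
      exact key _ ∅
    · rw [lt_iff_le_not_ge, lt_iff_le_not_ge, key, key]
  | next φ => exact hφ.elim

/-- On a run of infinite lifetime every time is within the lifetime, so `next` may be applied freely
outside the other modalities. Inside them it could pass the end of the lifetime of another run,
where agreement is no longer guaranteed. -/
theorem tagged_sat_iff (hcoh : I.Coherent) (hsync : I.Synchronous)
    (hrec : I.PerfectRecall) (hcons : I.CONS) (hpers : I.PERSIST) (φ : Formula n Φ)
    (hφ : φ.TemporallyLinear) (r : I.Run) (m : ℕ) :
    I.Sat (r, m) φ ↔ I.tagged.Sat (tag r ⊤, m) φ := by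
  have key : ∀ φ : Formula n Φ, φ.TimeFree → (I.Sat (r, m) φ ↔ I.tagged.Sat (tag r ⊤, m) φ) :=
    fun φ hφ => (tagged_sat_iff_of_timeFree hcoh hsync hrec hcons hpers φ hφ (tag r ⊤) m
      le_top).symm
  induction φ generalizing m with
  | prim a => exact key _ hφ
  | neg φ ih => exact not_congr (ih hφ m key)
  | conj φ ψ ih ih' => exact and_congr (ih hφ.1 m key) (ih' hφ.2 m key)
  | know i φ => exact key _ hφ
  | cond i φ ψ => exact key _ hφ
  | next φ ih =>
    exact ih hφ (m + 1) fun φ hφ => (tagged_sat_iff_of_timeFree hcoh hsync hrec hcons hpers φ hφ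
      (tag r ⊤) (m + 1) le_top).symm

end InterpretedSystem

theorem mainTheorem9 {n : ℕ} {Φ : Type v} (𝒜 : Set Condition)
    (I : InterpretedSystem.{u, v} n Φ)
    (hcoh : I.Coherent) (hsync : I.Synchronous) (hrec : I.PerfectRecall)
    (hcons : I.CONS) (hpers : I.PERSIST) (hA : ∀ c ∈ 𝒜, I.Holds c) :
    ∃ I' : InterpretedSystem.{u, v} n Φ,
      I'.Synchronous ∧ I'.PerfectRecall ∧ I'.PRIOR ∧ (∀ c ∈ 𝒜, I'.Holds c) ∧
      ∃ f : I.Run → I'.Run,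
        ∀ φ : Formula n Φ, φ.TemporallyLinear →
          ∀ (r : I.Run) (m : ℕ), I.Sat (r, m) φ ↔ I'.Sat (f r, m) φ := by
  refine ⟨I.tagged, InterpretedSystem.tagged_synchronous hsync,
    InterpretedSystem.tagged_perfectRecall hrec, InterpretedSystem.tagged_prior hsync,
    fun c hc => ?_, fun r => InterpretedSystem.TaggedRun.tag r ⊤,
    InterpretedSystem.tagged_sat_iff hcoh hsync hrec hcons hpers⟩
  have h := hA c hc
  cases c with
  | QUAL => exact InterpretedSystem.tagged_qual h
  | NORM => exact InterpretedSystem.tagged_norm hcoh hcons hsync h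
  | REF => exact InterpretedSystem.tagged_ref h
  | SDP => exact InterpretedSystem.tagged_sdp hsync hrec h
  | UNIF => exact InterpretedSystem.tagged_unif hsync hrec hcons hpers h
  | RANK => exact InterpretedSystem.tagged_rank h
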